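/- Let $\gamma_1,\gamma_2,C,x_0>0$, $T=2\gamma_2$ and $\rho=\sqrt{2/5}\,\gamma_1$. Let $g\in C^\infty[0,T]$ satisfy $g^{(n)}(0)=0$ for all $n\ge 0$ (that is, $g\in M[0,T]$) and $$\sup_{0<t<2\gamma_2}|g^{(n)}(t)|<C\,\frac{(2n)!}{\gamma_1^{2n}}\qquad(n=0,1,2,\dots)$$ (that is, $g$ lies in the Holmgren class $\mathcal H_l(\gamma_1,\gamma_2,C)$). For $\nu>0$ with integer part $m=\lfloor\nu\rfloor$ let $$\partial_t^{\nu}g(t)=\frac{1}{\Gamma(m-\nu+1)}\,\frac{d^{m+1}}{dt^{m+1}}\int_0^t(t-\tau)^{m-\nu}g(\tau)\,d\tau$$ be the Riemann--Liouville derivative on $[0,T]$. Then each of the two series in $$u(x,t)=\sum_{n=0}^\infty \partial_t^{n}g(t)\,\frac{(x_0-x)^{2n}}{(2n)!}+\sum_{n=0}^\infty\partial_t^{\,n+\frac12}g(t)\,\frac{(x_0-x)^{2n+1}}{(2n+1)!}$$ converges absolutely and uniformly on $\{|x_0-x|\le r\}\times[0,T]$ for every $r<\rho$. The sum $u$ is,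 for $|x_0-x|<\rho$ and $0\le t\le T$, a classical solution ($u$, $u_x$, $u_{xx}$, $u_t$ exist and are continuous, one-sided in $t$ at $t=0,T$) of the inverse heat problem $$u_{xx}=u_t,\qquad u(x_0,t)=g(t),\qquad u(x,0)=0 .$$ Moreover, it is the restriction of a solution on the semi-infinite bar: there is a classical solution $w$ of the same three equations for all $x>x_0-\rho$ and $0\le t\le T$ (hence for all $x\ge 0$ if $x_0<\rho$) with $w=u$ for $|x_0-x|<\rho$. -/

import Mathlib

open Set Filter Topology
open scoped ContDiff Nat

noncomputable section

/-- The space `M[0,T]`: functions that are smooth on the closed interval `[0,T]` (one-sided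
derivatives at the end points) and vanish at `0` together with all their derivatives. -/
def FlatSmooth (T : ℝ) : Set (ℝ → ℝ) :=
  {f : ℝ → ℝ | ContDiffOn ℝ ∞ f (Icc 0 T) ∧ ∀ n : ℕ, iteratedDerivWithin n f (Icc 0 T) 0 = 0}

/-- The Holmgren class `H(γ₁,γ₂,C,t₀)`: functions that are smooth on `|t - t₀| < γ₂` and satisfy
`sup_{|t - t₀| < γ₂} |f⁽ⁿ⁾(t)| < C (2n)! / γ₁^(2n)` for every `n ≥ 0`.  That the supremum is
finite and less than a number `A` is written as: some `B < A` is an upper bound. -/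
def Holmgren (γ₁ γ₂ C t₀ : ℝ) : Set (ℝ → ℝ) :=
  {f : ℝ → ℝ | ContDiffOn ℝ ∞ f (Metric.ball t₀ γ₂) ∧
    ∀ n : ℕ, ∃ B < C * ((2 * n)! : ℝ) / γ₁ ^ (2 * n),
      ∀ t ∈ Metric.ball t₀ γ₂, |iteratedDerivWithin n f (Metric.ball t₀ γ₂) t| ≤ B}

/-- The class `H_l(γ₁,γ₂,C) = H(γ₁,γ₂,C,γ₂)`. -/
def HolmgrenL (γ₁ γ₂ C : ℝ) : Set (ℝ → ℝ) := Holmgren γ₁ γ₂ C γ₂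

/-- The fractional integral `J^α_{0,t} f = Γ(α)⁻¹ ∫₀ᵗ (t - τ)^(α-1) f(τ) dτ`. -/
def fracIntegral (α : ℝ) (f : ℝ → ℝ) (t : ℝ) : ℝ :=
  (Real.Gamma α)⁻¹ * ∫ τ in (0 : ℝ)..t, (t - τ) ^ (α - 1) * f τ

/-- The Riemann-Liouville derivative `∂_t^ν f = ∂_t^(m+1) J^(m-ν+1)_{0,t} f`, `m = ⌊ν⌋`, of order
`ν > 0` on the interval `[0,T]`. -/
def fracDeriv (T ν : ℝ) (f : ℝ → ℝ) (t : ℝ) : ℝ :=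
  iteratedDerivWithin (⌊ν⌋₊ + 1) (fracIntegral ((⌊ν⌋₊ : ℝ) - ν + 1) f) (Icc 0 T) t

/-- `∂_tⁿ g(t) (x₀ - x)^(2n) / (2n)!`, the derivative being taken on `[0,T]`. -/
def evenTerm (g : ℝ → ℝ) (x₀ T : ℝ) (n : ℕ) (x t : ℝ) : ℝ :=
  iteratedDerivWithin n g (Icc 0 T) t * ((x₀ - x) ^ (2 * n) / ((2 * n)! : ℝ))

/-- `∂_t^(n+1/2) g(t) (x₀ - x)^(2n+1) / (2n+1)!`. -/
def oddTerm (g : ℝ → ℝ) (x₀ T : ℝ) (n : ℕ) (x t : ℝ) : ℝ :=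
  fracDeriv T ((n : ℝ) + 1 / 2) g t * ((x₀ - x) ^ (2 * n + 1) / ((2 * n + 1)! : ℝ))

/-- The sum of the two series. -/
def heatSeries (g : ℝ → ℝ) (x₀ T x t : ℝ) : ℝ :=
  (∑' n : ℕ, evenTerm g x₀ T n x t) + ∑' n : ℕ, oddTerm g x₀ T n x t

/-- The series `∑ f n x t` converges absolutely at every point of `S`, and its partial sums
converge uniformly on `S`. -/
def ConvergesAbsUnifOn (f : ℕ → ℝ → ℝ → ℝ) (S : Set (ℝ × ℝ)) : Prop :=
  (∀ p ∈ S, Summable fun n => |f n p.1 p.2|) ∧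
    TendstoUniformlyOn (fun (N : ℕ) (p : ℝ × ℝ) => ∑ n ∈ Finset.range N, f n p.1 p.2)
      (fun p => ∑' n, f n p.1 p.2) atTop S

/-- `u` is a classical solution, for positions `x ∈ X` and times `t ∈ [0,T]`, of
`u_xx = u_t`, `u(x₀,t) = g(t)`, `u(x,0) = 0`: the function `u` and its derivatives `u_x` and
`u_xx = u_t` exist and are continuous on `X × [0,T]`. -/
structure SolvesInverseHeat (X : Set ℝ) (x₀ T : ℝ) (g : ℝ → ℝ) (u : ℝ → ℝ → ℝ) : Prop where
  continuousOn : ContinuousOn (fun p : ℝ × ℝ => u p.1 p.2) (X ×ˢ Icc 0 T)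
  heat : ∃ v q : ℝ → ℝ → ℝ,
    ContinuousOn (fun p : ℝ × ℝ => v p.1 p.2) (X ×ˢ Icc 0 T) ∧
    ContinuousOn (fun p : ℝ × ℝ => q p.1 p.2) (X ×ˢ Icc 0 T) ∧
    ∀ x ∈ X, ∀ t ∈ Icc 0 T,
      HasDerivWithinAt (fun y => u y t) (v x t) X x ∧
      HasDerivWithinAt (fun y => v y t) (q x t) X x ∧
      HasDerivWithinAt (fun s => u x s) (q x t) (Icc 0 T) t
  data : ∀ t ∈ Icc 0 T, u x₀ t = g t
  initial : ∀ x ∈ X, u x 0 = 0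

end

/-!
Put `T = 2γ₂` and `y = x - x₀`. On `y > 0` the heat equation with zero initial values and boundary
values `g` at `y = 0` is solved by the convolution of `g'` in time with the kernel
`K(y,s) = erfc(y/(2√s))`. Let `E(y,s) = exp(-y²/(4s))/√(πs)`. From `∂_y K = -E`, `∂_y E = -∂_s K`
and the flatness of `g` at `0`, the functions

  `f_{2n}(y,t) = ∫ K(y,s) g⁽ⁿ⁺¹⁾(t - s) ds`,  `f_{2n+1}(y,t) = ∫ E(y,s) g⁽ⁿ⁺¹⁾(t - s) ds`

(`layerMode`) satisfy `∂_y f_k = -f_{k+1}` for `y > 0` and `∂_t f_k = f_{k+2}`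
(`FlatDerivSeq.hasDerivAt_layerMode_left`, `FlatDerivSeq.hasDerivWithinAt_layerMode_right`).
At `y = 0` one has `K = 1` and `E = 1/√(πs)`, so that `f_{2n}(0,t)` is `g⁽ⁿ⁾(t)` and
`f_{2n+1}(0,t)` is the Riemann-Liouville derivative of `g` of order `n + 1/2`. The two series of the
theorem are thus the even and odd parts of the single series `∑ f_k(0,t) (-y)ᵏ / k!`.

Both kernels have a common integrable bound in `s`, independent of `y`, and the Holmgren condition
therefore gives `|f_k(y,t)| ≤ B (k + 2)! / γ₁ᵏ`. Since the coefficients exceed `k! / γ₁ᵏ` by at most a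
polynomial factor, the series and all its termwise derivatives converge locally uniformly for
`|y| < γ₁`, a larger range than `|y| < √(2/5) γ₁`, and `∂_t f_k = f_{k+2}` makes the sum a solution.
The same bound sends the remainder in Taylor's formula for `f_0(·,t)` on `[0,y]` to zero, so that
the series equals the convolution for `0 < y < γ₁` (`FlatDerivSeq.expSeries_eq_layerMode`). The
series on the left and the convolution on the right hence glue to a solution on the semi-infinite
bar (`FlatDerivSeq.solvesInverseHeat_barSolution`).
-/

noncomputable section

open MeasureTheory

/-! ### Convolution over a finite time interval -/

/-- The convolution `∫₀ᵀ κ(s) h(t - s) ds`. The range of integration does not depend on `t`; for `h`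
vanishing on `(-∞, 0]` and `t ∈ [0, T]` this is the causal convolution over `[0, t]`, see
`heatConv_eq_integral_of_eq_zero`. -/
def heatConv (T : ℝ) (κ h : ℝ → ℝ) (t : ℝ) : ℝ := ∫ s in (0 : ℝ)..T, κ s * h (t - s)

theorem intervalIntegrable_mul_comp_sub {T : ℝ} {κ h : ℝ → ℝ}
    (hκ : IntervalIntegrable κ volume 0 T) (hh : Continuous h) (t : ℝ) :
    IntervalIntegrable (fun s => κ s * h (t - s)) volume 0 T :=
  hκ.mul_continuousOn (by fun_prop)

theorem hasDerivAt_heatConv {T M : ℝ} {κ H h : ℝ → ℝ}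
    (hκ : IntervalIntegrable κ volume 0 T) (hh : Continuous h) (hM : ∀ t, |h t| ≤ M)
    (hH : ∀ t, HasDerivAt H (h t) t) (t : ℝ) :
    HasDerivAt (heatConv T κ H) (heatConv T κ h t) t := by
  have hHc : Continuous H := continuous_iff_continuousAt.2 fun t => (hH t).continuousAt
  refine (intervalIntegral.hasDerivAt_integral_of_dominated_loc_of_deriv_le
    (F := fun t s => κ s * H (t - s)) (F' := fun t s => κ s * h (t - s))
    (bound := fun s => |κ s| * M) (s := univ) univ_mem ?_ ?_ ?_ ?_ ?_ ?_).2
  · exact Eventually.of_forall fun t =>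
      (intervalIntegrable_iff.1 (intervalIntegrable_mul_comp_sub hκ hHc t)).aestronglyMeasurable
  · exact intervalIntegrable_mul_comp_sub hκ hHc t
  · exact (intervalIntegrable_iff.1 (intervalIntegrable_mul_comp_sub hκ hh t)).aestronglyMeasurable
  · refine ae_of_all _ fun s _ t _ => ?_
    rw [Real.norm_eq_abs, abs_mul]
    exact mul_le_mul_of_nonneg_left (hM _) (abs_nonneg _)
  · exact hκ.abs.mul_const M
  · refine ae_of_all _ fun s _ t _ => ?_
    have := (hH (t - s)).comp t ((hasDerivAt_id t).sub_const s)
    simpa using this.const_mul (κ s)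

/-- At times in `[0, T]` the convolution uses the values of `H` on `(-∞, T]` only, so that `H` need
be a primitive of `h` there only; the derivative at `t = T` is one-sided. -/
theorem hasDerivWithinAt_heatConv {T M : ℝ} {κ H h : ℝ → ℝ}
    (hκ : IntervalIntegrable κ volume 0 T) (hh : Continuous h) (hM : ∀ t, |h t| ≤ M)
    (hH : ∀ t ≤ T, H t = ∫ s in (0 : ℝ)..t, h s) {t : ℝ} (ht : t ∈ Icc 0 T) :
    HasDerivWithinAt (heatConv T κ H) (heatConv T κ h t) (Icc 0 T) t := by
  have key : ∀ t ∈ Icc 0 T,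
      heatConv T κ H t = heatConv T κ (fun r => ∫ s in (0 : ℝ)..r, h s) t := by
    intro t ht
    refine intervalIntegral.integral_congr fun s hs => ?_
    rw [uIcc_of_le (ht.1.trans ht.2)] at hs
    simp only [hH (t - s) (by linarith [hs.1, ht.2])]
  refine ((hasDerivAt_heatConv hκ hh hM (fun t => ?_) t).hasDerivWithinAt).congr key (key t ht)
  exact intervalIntegral.integral_hasDerivAt_right (hh.intervalIntegrable _ _)
    (hh.stronglyMeasurableAtFilter _ _) hh.continuousAt

/-- Joint continuity in the kernel parameter and the time, for kernels with a common integrable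
bound; the bound may be singular at `s = 0`. -/
theorem continuous_heatConv {T M : ℝ} (hT : 0 ≤ T) {κ : ℝ → ℝ → ℝ} {β h : ℝ → ℝ}
    (hm : ∀ y, Measurable (κ y)) (hb : ∀ y s, 0 < s → |κ y s| ≤ β s)
    (hβ : IntervalIntegrable β volume 0 T) (hc : ∀ s, 0 < s → Continuous fun y => κ y s)
    (hh : Continuous h) (hM : ∀ t, |h t| ≤ M) :
    Continuous fun p : ℝ × ℝ => heatConv T (κ p.1) h p.2 := by
  refine intervalIntegral.continuous_of_dominated_interval (bound := fun s => β s * M) ?_ ?_ ?_ ?_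
  · intro p
    exact ((hm p.1).mul
      (hh.measurable.comp (measurable_const.sub measurable_id))).aestronglyMeasurable
  · refine fun p => ae_of_all _ fun s hs => ?_
    rw [uIoc_of_le hT] at hs
    rw [Real.norm_eq_abs, abs_mul]
    exact mul_le_mul (hb _ _ hs.1) (hM _) (abs_nonneg _) ((abs_nonneg _).trans (hb p.1 s hs.1))
  · exact hβ.mul_const M
  · refine ae_of_all _ fun s hs => ?_
    rw [uIoc_of_le hT] at hs
    exact ((hc s hs.1).comp continuous_fst).mul (hh.comp (continuous_snd.sub continuous_const))

theorem abs_heatConv_le {T M t : ℝ} (hT : 0 ≤ T) {κ β h : ℝ → ℝ}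
    (hb : ∀ s, 0 < s → |κ s| ≤ β s) (hβ : IntervalIntegrable β volume 0 T)
    (hM : ∀ t, |h t| ≤ M) : |heatConv T κ h t| ≤ (∫ s in (0 : ℝ)..T, β s) * M := by
  rw [← intervalIntegral.integral_mul_const]
  refine intervalIntegral.norm_integral_le_of_norm_le (f := fun s => κ s * h (t - s)) hT
    (ae_of_all _ fun s hs => ?_) (hβ.mul_const M)
  rw [Real.norm_eq_abs, abs_mul]
  exact mul_le_mul (hb _ hs.1) (hM _) (abs_nonneg _) ((abs_nonneg _).trans (hb s hs.1))

theorem hasDerivAt_heatConv_kernel {T M y : ℝ} (hT : 0 ≤ T) {κ κ' : ℝ → ℝ → ℝ} {b h : ℝ → ℝ}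
    {S : Set ℝ} (hS : S ∈ 𝓝 y)
    (hκ : ∀ y, IntervalIntegrable (κ y) volume 0 T) (hm : Measurable (κ' y))
    (hb : ∀ s, 0 < s → ∀ z ∈ S, |κ' z s| ≤ b s) (hbi : IntervalIntegrable b volume 0 T)
    (hd : ∀ s, 0 < s → ∀ z ∈ S, HasDerivAt (fun z => κ z s) (κ' z s) z)
    (hh : Continuous h) (hM : ∀ t, |h t| ≤ M) (t : ℝ) :
    IntervalIntegrable (fun s => κ' y s * h (t - s)) volume 0 T ∧
      HasDerivAt (fun y => heatConv T (κ y) h t) (heatConv T (κ' y) h t) y := by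
  refine intervalIntegral.hasDerivAt_integral_of_dominated_loc_of_deriv_le
    (F := fun y s => κ y s * h (t - s)) (F' := fun y s => κ' y s * h (t - s))
    (bound := fun s => b s * M) hS ?_ ?_ ?_ ?_ ?_ ?_
  · exact Eventually.of_forall fun y =>
      (intervalIntegrable_iff.1 (intervalIntegrable_mul_comp_sub (hκ y) hh t)).aestronglyMeasurable
  · exact intervalIntegrable_mul_comp_sub (hκ y) hh t
  · exact (hm.mul (hh.measurable.comp (measurable_const.sub measurable_id))).aestronglyMeasurable
  · refine ae_of_all _ fun s hs z hz => ?_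
    rw [uIoc_of_le hT] at hs
    rw [Real.norm_eq_abs, abs_mul]
    exact mul_le_mul (hb _ hs.1 _ hz) (hM _) (abs_nonneg _)
      ((abs_nonneg _).trans (hb s hs.1 z hz))
  · exact hbi.mul_const M
  · refine ae_of_all _ fun s hs z hz => ?_
    rw [uIoc_of_le hT] at hs
    exact (hd s hs.1 z hz).mul_const _

/-! ### The error function and heat kernels -/

/-- The complementary error function `1 - (2/√π) ∫₀ˣ exp(-z²) dz`. -/
def erfc (x : ℝ) : ℝ := 1 - 2 / √Real.pi * ∫ z in (0 : ℝ)..x, Real.exp (-1 * z ^ 2)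

/-- The kernel `K(y,s) = erfc(y / (2√s))`, the response at distance `y` and time `s` to a unit step
in the boundary temperature. -/
def erfcKernel (y s : ℝ) : ℝ := erfc (y / (2 * √s))

/-- The kernel `E(y,s) = exp(-y²/(4s)) / √(πs)`, for which `∂_y K = -E`. -/
def heatKernel (y s : ℝ) : ℝ := Real.exp (-(y ^ 2 / (4 * s))) / √(Real.pi * s)

theorem hasDerivAt_erfc (x : ℝ) :
    HasDerivAt erfc (-(2 / √Real.pi * Real.exp (-1 * x ^ 2))) x := by
  have hc : Continuous fun z : ℝ => Real.exp (-1 * z ^ 2) := by fun_prop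
  exact ((intervalIntegral.integral_hasDerivAt_right (hc.intervalIntegrable _ _)
    (hc.stronglyMeasurableAtFilter _ _) hc.continuousAt).const_mul _).const_sub 1

theorem continuous_erfc : Continuous erfc :=
  continuous_iff_continuousAt.2 fun x => (hasDerivAt_erfc x).continuousAt

theorem erfc_zero : erfc 0 = 1 := by simp [erfc]

theorem tendsto_erfc_atTop : Tendsto erfc atTop (𝓝 0) := by
  have h := intervalIntegral_tendsto_integral_Ioi (μ := volume) 0
    (integrable_exp_neg_mul_sq one_pos).integrableOn tendsto_id
  rw [integral_gaussian_Ioi] at h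
  have h2 := (h.const_mul (2 / √Real.pi)).const_sub 1
  have hpi : √Real.pi ≠ 0 := by positivity
  have e : 1 - 2 / √Real.pi * (√(Real.pi / 1) / 2) = 0 := by
    rw [div_one]; field_simp; ring
  rw [e] at h2
  exact h2

theorem abs_erfc_le (x : ℝ) : |erfc x| ≤ 2 := by
  have key : |∫ z in (0 : ℝ)..x, Real.exp (-1 * z ^ 2)| ≤ √Real.pi / 2 := by
    have aux : ∀ x : ℝ, 0 ≤ x → |∫ z in (0 : ℝ)..x, Real.exp (-1 * z ^ 2)| ≤ √Real.pi / 2 := by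
      intro x hx
      rw [abs_of_nonneg (intervalIntegral.integral_nonneg hx fun z _ => (Real.exp_pos _).le),
        intervalIntegral.integral_of_le hx]
      have h := integral_gaussian_Ioi 1
      rw [div_one] at h
      rw [← h]
      exact setIntegral_mono_set (integrable_exp_neg_mul_sq one_pos).integrableOn
        (ae_of_all _ fun z => (Real.exp_pos _).le) Ioc_subset_Ioi_self.eventuallyLE
    rcases le_total 0 x with hx | hx
    · exact aux x hx
    · have h := intervalIntegral.integral_comp_neg (a := 0) (b := x)
        (fun z : ℝ => Real.exp (-1 * z ^ 2))
      simp only [neg_sq, neg_zero] at h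
      rw [h, intervalIntegral.integral_symm, abs_neg]
      exact aux (-x) (by linarith)
  have hpi : 0 < √Real.pi := by positivity
  have h2 : |2 / √Real.pi * ∫ z in (0 : ℝ)..x, Real.exp (-1 * z ^ 2)| ≤ 1 := by
    rw [abs_mul, abs_of_pos (by positivity : 0 < 2 / √Real.pi)]
    calc _ ≤ 2 / √Real.pi * (√Real.pi / 2) := by gcongr
      _ = 1 := by field_simp
  rw [abs_le] at h2 ⊢
  unfold erfc
  constructor <;> linarith

theorem measurable_erfcKernel (y : ℝ) : Measurable (erfcKernel y) :=
  continuous_erfc.measurable.comp (by fun_prop)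

theorem measurable_heatKernel (y : ℝ) : Measurable (heatKernel y) := by
  unfold heatKernel; fun_prop

theorem continuous_erfcKernel (s : ℝ) : Continuous fun y => erfcKernel y s :=
  continuous_erfc.comp (by fun_prop)

theorem continuous_heatKernel (s : ℝ) : Continuous fun y => heatKernel y s := by
  unfold heatKernel; fun_prop

/-- A bound for both kernels that is integrable at `s = 0`. -/
def kernelBound (s : ℝ) : ℝ := 2 + s ^ (-(1 / 2) : ℝ)

theorem intervalIntegrable_kernelBound (a b : ℝ) :
    IntervalIntegrable kernelBound volume a b :=
  (intervalIntegrable_const).add (intervalIntegral.intervalIntegrable_rpow' (by norm_num))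

theorem kernelBound_nonneg {s : ℝ} (hs : 0 < s) : 0 ≤ kernelBound s := by
  unfold kernelBound; positivity

theorem rpow_neg_half (s : ℝ) (hs : 0 < s) : s ^ (-(1 / 2) : ℝ) = 1 / √s := by
  rw [Real.rpow_neg hs.le, Real.sqrt_eq_rpow, one_div (s ^ _)]

theorem abs_erfcKernel_le (y s : ℝ) (hs : 0 < s) : |erfcKernel y s| ≤ kernelBound s := by
  have := Real.rpow_nonneg hs.le (-(1 / 2) : ℝ)
  have := abs_erfc_le (y / (2 * √s))
  unfold kernelBound erfcKernel
  linarith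

theorem inv_sqrt_pi_mul_le (s : ℝ) (hs : 0 < s) : 1 / √(Real.pi * s) ≤ kernelBound s := by
  have h1 : s ≤ Real.pi * s := by nlinarith [Real.pi_gt_three]
  have h2 : 1 / √(Real.pi * s) ≤ 1 / √s :=
    one_div_le_one_div_of_le (Real.sqrt_pos.2 hs) (Real.sqrt_le_sqrt h1)
  rw [← rpow_neg_half s hs] at h2
  unfold kernelBound
  linarith

theorem abs_heatKernel_le (y s : ℝ) (hs : 0 < s) : |heatKernel y s| ≤ kernelBound s := by
  have hp : 0 < √(Real.pi * s) := by positivity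
  refine le_trans ?_ (inv_sqrt_pi_mul_le s hs)
  unfold heatKernel
  rw [abs_of_pos (by positivity)]
  gcongr
  exact Real.exp_le_one_iff.2 (neg_nonpos.2 (by positivity))

theorem hasDerivAt_erfcKernel_left (y s : ℝ) (hs : 0 < s) :
    HasDerivAt (fun y => erfcKernel y s) (-heatKernel y s) y := by
  have h := (hasDerivAt_erfc (y / (2 * √s))).comp y ((hasDerivAt_id y).div_const (2 * √s))
  refine h.congr_deriv ?_
  have hs' : √s ≠ 0 := by positivity
  have hpi : √Real.pi ≠ 0 := by positivity
  have e : -1 * (y / (2 * √s)) ^ 2 = -(y ^ 2 / (4 * s)) := by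
    rw [div_pow, mul_pow, Real.sq_sqrt hs.le]; ring
  rw [e, heatKernel, Real.sqrt_mul Real.pi_pos.le]
  field_simp

/-- The `y`-derivative of the heat kernel, which is also minus the `s`-derivative of the error
function kernel. -/
def heatKernelDeriv (y s : ℝ) : ℝ := -(y / (2 * s)) * heatKernel y s

theorem hasDerivAt_heatKernel_left (y s : ℝ) :
    HasDerivAt (fun y => heatKernel y s) (heatKernelDeriv y s) y := by
  have h := ((((hasDerivAt_id y).pow 2).div_const (4 * s)).neg.exp).div_const (√(Real.pi * s))
  refine h.congr_deriv ?_
  simp only [heatKernelDeriv, heatKernel, id]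
  rcases eq_or_ne s 0 with rfl | hs
  · simp
  · field_simp; simp; ring

theorem hasDerivAt_erfcKernel_right (y s : ℝ) (hs : 0 < s) :
    HasDerivAt (fun s => erfcKernel y s) (-heatKernelDeriv y s) s := by
  have hs' : √s ≠ 0 := by positivity
  have hpi : √Real.pi ≠ 0 := by positivity
  have h1 := (hasDerivAt_const s y).div ((Real.hasDerivAt_sqrt hs.ne').const_mul 2)
    (by positivity)
  have h := (hasDerivAt_erfc (y / (2 * √s))).comp s h1
  refine h.congr_deriv ?_
  have e : -1 * (y / (2 * √s)) ^ 2 = -(y ^ 2 / (4 * s)) := by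
    rw [div_pow, mul_pow, Real.sq_sqrt hs.le]; ring
  rw [e, heatKernelDeriv, heatKernel, Real.sqrt_mul Real.pi_pos.le]
  have e2 : s = √s ^ 2 := (Real.sq_sqrt hs.le).symm
  generalize Real.exp (-(y ^ 2 / (4 * s))) = X
  generalize √s = q at *
  subst e2
  field_simp
  ring

theorem measurable_heatKernelDeriv (y : ℝ) : Measurable (heatKernelDeriv y) := by
  unfold heatKernelDeriv heatKernel; fun_prop

/-- Away from `y = 0` the derivative of the heat kernel is no more singular at `s = 0` than the
kernel itself, because `x exp(-x) ≤ 1` for `x = z²/(4s)`. -/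
theorem abs_heatKernelDeriv_le (y z s : ℝ) (hy : 0 < y) (hz : y ≤ z) (hs : 0 < s) :
    |heatKernelDeriv z s| ≤ 2 / y * kernelBound s := by
  have hz0 : 0 < z := hy.trans_le hz
  have hx : z ^ 2 / (4 * s) * Real.exp (-(z ^ 2 / (4 * s))) ≤ 1 := by
    rw [Real.exp_neg, ← div_eq_mul_inv, div_le_one (Real.exp_pos _)]
    linarith [Real.add_one_le_exp (z ^ 2 / (4 * s))]
  have hp : 0 < √(Real.pi * s) := by positivity
  -- the factor `z / (2s)` is `(2/z) · z²/(4s)`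
  have e : |heatKernelDeriv z s|
      = 2 / z * (z ^ 2 / (4 * s) * Real.exp (-(z ^ 2 / (4 * s)))) * (1 / √(Real.pi * s)) := by
    unfold heatKernelDeriv heatKernel
    rw [neg_mul, abs_neg, abs_of_pos (by positivity)]
    field_simp
    norm_num
  rw [e]
  calc _ ≤ 2 / z * 1 * kernelBound s := by
        gcongr
        exact inv_sqrt_pi_mul_le s hs
    _ ≤ _ := by
      rw [mul_one]
      have := kernelBound_nonneg hs
      gcongr

theorem tendsto_erfcKernel_zero {y : ℝ} (hy : 0 < y) :
    Tendsto (fun s => erfcKernel y s) (𝓝[>] 0) (𝓝 0) := by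
  refine tendsto_erfc_atTop.comp ?_
  refine Tendsto.const_mul_atTop hy (tendsto_inv_nhdsGT_zero.comp ?_)
  refine tendsto_nhdsWithin_iff.2 ⟨?_, ?_⟩
  · have : Continuous fun s : ℝ => 2 * √s := by fun_prop
    simpa using (this.tendsto 0).mono_left nhdsWithin_le_nhds
  · filter_upwards [self_mem_nhdsWithin] with s hs
    exact mul_pos two_pos (Real.sqrt_pos.2 hs)

theorem intervalIntegrable_of_kernelBound {T : ℝ} (hT : 0 ≤ T) {κ : ℝ → ℝ} (hm : Measurable κ)
    (hb : ∀ s, 0 < s → |κ s| ≤ kernelBound s) : IntervalIntegrable κ volume 0 T := by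
  refine (intervalIntegrable_kernelBound 0 T).mono_fun hm.aestronglyMeasurable ?_
  filter_upwards [ae_restrict_mem measurableSet_uIoc] with s hs
  rw [uIoc_of_le hT] at hs
  exact (hb s hs.1).trans (le_abs_self _)

/-- Integration by parts moves the time derivative from the kernel to the data: since
`∂_y E = -∂_s K`, and both boundary terms vanish for `y > 0` and `t ≤ T`. -/
theorem heatConv_heatKernelDeriv {T y t : ℝ} (hT : 0 < T) (hy : 0 < y) {h h' : ℝ → ℝ}
    (hh : Continuous h) (hh' : Continuous h')
    (hd : ∀ t < T, HasDerivAt h (h' t) t) (h0 : ∀ t ≤ 0, h t = 0) (ht : t ≤ T) :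
    heatConv T (heatKernelDeriv y) h t = -heatConv T (erfcKernel y) h' t := by
  have hK : IntervalIntegrable (erfcKernel y) volume 0 T :=
    intervalIntegrable_of_kernelBound hT.le (measurable_erfcKernel y) (abs_erfcKernel_le y)
  have hE : IntervalIntegrable (heatKernelDeriv y) volume 0 T := by
    refine ((intervalIntegrable_kernelBound 0 T).const_mul (2 / y)).mono_fun
      (measurable_heatKernelDeriv y).aestronglyMeasurable ?_
    filter_upwards [ae_restrict_mem measurableSet_uIoc] with s hs
    rw [uIoc_of_le hT.le] at hs
    exact (abs_heatKernelDeriv_le y y s hy le_rfl hs.1).trans (le_abs_self _)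
  have i1 : IntervalIntegrable (fun s => -(heatKernelDeriv y s * h (t - s))) volume 0 T :=
    (intervalIntegrable_mul_comp_sub hE hh t).neg
  have i2 := intervalIntegrable_mul_comp_sub hK hh' t
  have key := intervalIntegral.integral_eq_sub_of_hasDerivAt_of_tendsto hT
    (f := fun s => erfcKernel y s * h (t - s))
    (f' := fun s => -(heatKernelDeriv y s * h (t - s)) - erfcKernel y s * h' (t - s))
    (fa := 0) (fb := 0) ?_ (i1.sub i2) ?_ ?_
  · rw [intervalIntegral.integral_sub i1 i2, intervalIntegral.integral_neg] at key
    unfold heatConv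
    linarith
  · intro s hs
    have h1 := (hd (t - s) (by linarith [hs.1])).comp s ((hasDerivAt_id s).const_sub t)
    refine ((hasDerivAt_erfcKernel_right y s hs.1).mul h1).congr_deriv ?_
    simp only [Function.comp]
    ring
  · have : Continuous fun s => h (t - s) := by fun_prop
    simpa using (tendsto_erfcKernel_zero hy).mul ((this.tendsto 0).mono_left nhdsWithin_le_nhds)
  · have c1 : Continuous fun s => h (t - s) := by fun_prop
    have c2 := (hasDerivAt_erfcKernel_right y T hT).continuousAt.tendsto
    have := (c2.mul (c1.tendsto T)).mono_left (nhdsWithin_le_nhds (s := Iio T))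
    rwa [h0 (t - T) (by linarith), mul_zero] at this

/-! ### Series and Taylor expansions under factorial bounds -/

/-- The sequence `c k` is bounded, uniformly in the variable, by `B (k + p)! / γ ^ k` for some `B`
and `p`. The shift `p` only costs a polynomial factor in `∑ c k z ^ k / k!`, which therefore converges
for `|z| < γ`. -/
def FactorialBound (γ : ℝ) (c : ℕ → ℝ → ℝ) : Prop :=
  ∃ (B : ℝ) (p : ℕ), ∀ k t, |c k t| ≤ B * ((k + p)! / γ ^ k)

/-- The exponential generating series `∑ c k t · z ^ k / k!`. -/
def expSeries (c : ℕ → ℝ → ℝ) (z t : ℝ) : ℝ := ∑' k : ℕ, c k t * (z ^ k / k !)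

theorem FactorialBound.shift {γ : ℝ} {c : ℕ → ℝ → ℝ} (hγ : 0 < γ) (h : FactorialBound γ c) :
    FactorialBound γ fun k => c (k + 1) := by
  obtain ⟨B, p, h⟩ := h
  refine ⟨B / γ, p + 1, fun k t => (h (k + 1) t).trans_eq ?_⟩
  rw [add_right_comm, add_assoc k p 1, pow_succ]
  field_simp

/-- The summable majorant on `|z| ≤ r < γ`: a polynomial in `k` times `(r / γ) ^ k`. -/
theorem FactorialBound.exists_summable {γ r : ℝ} {c : ℕ → ℝ → ℝ} (h : FactorialBound γ c)
    (hr : 0 ≤ r) (hrγ : r < γ) :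
    ∃ u : ℕ → ℝ, Summable u ∧ ∀ k t z, |z| ≤ r → |c k t * (z ^ k / k !)| ≤ u k := by
  obtain ⟨B, p, h⟩ := h
  have hγ : 0 < γ := hr.trans_lt hrγ
  refine ⟨fun k => B * (((k + p).descFactorial p : ℝ) * (r / γ) ^ k),
    (summable_descFactorial_mul_geometric_of_norm_lt_one p ?_).mul_left B, fun k t z hz => ?_⟩
  · rw [Real.norm_eq_abs, abs_of_nonneg (by positivity), div_lt_one hγ]
    exact hrγ
  · have hf : ((k + p)! : ℝ) = k ! * (k + p).descFactorial p := by
      have := Nat.factorial_mul_descFactorial (n := k + p) (k := p) (by omega)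
      rw [Nat.add_sub_cancel] at this
      exact_mod_cast this.symm
    calc |c k t * (z ^ k / k !)| = |c k t| * (|z| ^ k / k !) := by
          rw [abs_mul, abs_div, abs_pow, Nat.abs_cast]
      _ ≤ B * ((k + p)! / γ ^ k) * (r ^ k / k !) :=
          mul_le_mul (h k t) (by gcongr) (by positivity) ((abs_nonneg _).trans (h k t))
      _ = _ := by
          simp only [hf, div_pow]
          have : (k ! : ℝ) ≠ 0 := by positivity
          field_simp

theorem continuousAt_expSeries {γ z : ℝ} {c : ℕ → ℝ → ℝ} (h : FactorialBound γ c)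
    (hc : ∀ k, Continuous (c k)) (hz : |z| < γ) (t : ℝ) :
    ContinuousAt (fun p : ℝ × ℝ => expSeries c p.1 p.2) (z, t) := by
  obtain ⟨r, hzr, hrγ⟩ := exists_between hz
  obtain ⟨u, hu, hb⟩ := h.exists_summable ((abs_nonneg z).trans hzr.le) hrγ
  have hS : {p : ℝ × ℝ | |p.1| < r} ∈ 𝓝 (z, t) :=
    (isOpen_lt (by fun_prop) continuous_const).mem_nhds hzr
  refine (continuousOn_tsum (fun k => ?_) hu fun k p hp => hb k p.2 p.1 (le_of_lt hp)).continuousAt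
    hS
  exact (((hc k).comp continuous_snd).mul ((continuous_fst.pow k).div_const _)).continuousOn

theorem hasDerivAt_pow_div_factorial (k : ℕ) (z : ℝ) :
    HasDerivAt (fun z : ℝ => z ^ (k + 1) / (k + 1)!) (z ^ k / k !) z := by
  refine ((hasDerivAt_pow (k + 1) z).div_const _).congr_deriv ?_
  rw [Nat.factorial_succ]
  push_cast
  have : (k ! : ℝ) ≠ 0 := by positivity
  field_simp

theorem hasDerivAt_expSeries_left {γ z : ℝ} {c : ℕ → ℝ → ℝ} (h : FactorialBound γ c)
    (hz : |z| < γ) (t : ℝ) :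
    HasDerivAt (fun z => expSeries c z t) (expSeries (fun k => c (k + 1)) z t) z := by
  obtain ⟨r, hzr, hrγ⟩ := exists_between hz
  have hr : 0 ≤ r := (abs_nonneg z).trans hzr.le
  obtain ⟨u, hu, hb⟩ := h.exists_summable hr hrγ
  obtain ⟨v, hv, hb'⟩ := (h.shift (hr.trans_lt hrγ)).exists_summable hr hrγ
  have hs : ∀ z, |z| ≤ r → Summable fun k => c k t * (z ^ k / k !) := fun z hz =>
    Summable.of_norm_bounded hu fun k => hb k t z hz
  have key := hasDerivAt_tsum_of_isPreconnected (t := Metric.ball (0 : ℝ) r)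
    (g := fun k z => c (k + 1) t * (z ^ (k + 1) / (k + 1)!))
    (g' := fun k z => c (k + 1) t * (z ^ k / k !)) (y₀ := z) (y := z) hv Metric.isOpen_ball
    (convex_ball _ _).isPreconnected
    (fun k z _ => (hasDerivAt_pow_div_factorial k z).const_mul _)
    (fun k z hz => hb' k t z (by simpa using (mem_ball_zero_iff.1 hz).le))
    (by simpa using hzr) ((summable_nat_add_iff 1).2 (hs z hzr.le)) (by simpa using hzr)
  refine (key.const_add (c 0 t)).congr_of_eventuallyEq ?_
  filter_upwards [Metric.isOpen_ball.mem_nhds (show z ∈ Metric.ball (0 : ℝ) r by simpa using hzr)]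
    with w hw
  have hw' : |w| ≤ r := by simpa using (mem_ball_zero_iff.1 hw).le
  rw [expSeries, (hs w hw').tsum_eq_zero_add]
  simp

/-- Termwise differentiation in `t` on a closed interval. -/
theorem hasDerivWithinAt_expSeries_right {γ z T : ℝ} {c d : ℕ → ℝ → ℝ} (hd : FactorialBound γ d)
    (hc : ∀ k, ∀ t ∈ Icc 0 T, HasDerivWithinAt (c k) (d k t) (Icc 0 T) t)
    (hdc : ∀ k, Continuous (d k)) (h0 : ∀ k, c k 0 = 0) (hz : |z| < γ) {t : ℝ}
    (ht : t ∈ Icc 0 T) :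
    HasDerivWithinAt (fun t => expSeries c z t) (expSeries d z t) (Icc 0 T) t := by
  obtain ⟨u, hu, hb⟩ := hd.exists_summable (abs_nonneg z) hz
  have hprim : ∀ k, ∀ t ∈ Icc 0 T, c k t = ∫ s in (0 : ℝ)..t, d k s := by
    intro k t ht
    rw [intervalIntegral.integral_eq_sub_of_hasDerivAt_of_le (f := c k) ht.1, h0, sub_zero]
    · exact fun s hs => ((hc k s ⟨hs.1, hs.2.trans ht.2⟩).continuousWithinAt).mono
        (Icc_subset_Icc_right ht.2)
    · exact fun s hs => (hc k s ⟨hs.1.le, hs.2.le.trans ht.2⟩).hasDerivAt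
        (Icc_mem_nhds hs.1 (hs.2.trans_le ht.2))
    · exact (hdc k).intervalIntegrable _ _
  -- The primitives of `d k` agree with `c k` on `[0, T]` and are differentiable on all of `ℝ`, so
  -- that the theorem on differentiation of series over open sets applies to them.
  have key := hasDerivAt_tsum_of_isPreconnected (t := univ) (y := t) (y₀ := 0)
    (g := fun k t => (∫ s in (0 : ℝ)..t, d k s) * (z ^ k / k !))
    (g' := fun k t => d k t * (z ^ k / k !)) hu isOpen_univ isPreconnected_univ
    (fun k t _ => (intervalIntegral.integral_hasDerivAt_right ((hdc k).intervalIntegrable _ _)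
      ((hdc k).stronglyMeasurableAtFilter _ _) (hdc k).continuousAt).mul_const _)
    (fun k t _ => hb k t z le_rfl) (mem_univ _) (by simp [summable_zero]) (mem_univ _)
  refine key.hasDerivWithinAt.congr (fun s hs => ?_) ?_
  · exact tsum_congr fun k => by rw [hprim k s hs]
  · exact tsum_congr fun k => by rw [hprim k t ht]

/-- Taylor's formula with remainder for a chain of functions with `(f k)' = -f (k + 1)`, based
at `0` and going to the right. -/
theorem abs_sub_taylor_le {M Y : ℝ} (n : ℕ) : ∀ {f : ℕ → ℝ → ℝ},
    (∀ k, Continuous (f k)) →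
    (∀ k y, 0 ≤ y → HasDerivWithinAt (f k) (-(f (k + 1) y)) (Ici y) y) →
    (∀ y ∈ Icc 0 Y, |f n y| ≤ M) → ∀ y ∈ Icc 0 Y,
      |f 0 y - ∑ k ∈ Finset.range n, f k 0 * ((-y) ^ k / k !)| ≤ M * (y ^ n / n !) := by
  induction n with
  | zero => intro f _ _ hM y hy; simpa using hM y hy
  | succ n ih =>
    intro f hf hd hM
    have ih' := ih (f := fun k => f (k + 1)) (fun k => hf _) (fun k => hd _) hM
    have hder : ∀ y, HasDerivAt (fun y : ℝ => ∑ k ∈ Finset.range (n + 1), f k 0 * ((-y) ^ k / k !))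
        (-∑ k ∈ Finset.range n, f (k + 1) 0 * ((-y) ^ k / k !)) y := by
      intro y
      simp only [Finset.sum_range_succ']
      rw [← Finset.sum_neg_distrib]
      simp only [pow_zero]
      refine (HasDerivAt.fun_sum fun k _ => ?_).add_const _
      have := (hasDerivAt_pow_div_factorial k (-y)).comp y (hasDerivAt_neg y)
      refine (this.const_mul (f (k + 1) 0)).congr_deriv (by ring)
    refine fun y hy => image_norm_le_of_norm_deriv_right_le_deriv_boundary
      (f := fun y => f 0 y - ∑ k ∈ Finset.range (n + 1), f k 0 * ((-y) ^ k / k !))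
      (B := fun y => M * (y ^ (n + 1) / (n + 1)!)) (B' := fun y => M * (y ^ n / n !))
      (a := 0) (b := Y) ?_ (fun y hy => (hd 0 y hy.1).sub (hder y).hasDerivWithinAt) ?_
      (fun y => (hasDerivAt_pow_div_factorial n y).const_mul M) (fun y hy => ?_) hy
    · exact ((hf 0).sub (by fun_prop)).continuousOn
    · simp [Finset.sum_range_succ']
    · rw [← neg_sub', norm_neg]
      exact ih' y ⟨hy.1, hy.2.le⟩

/-- Under a factorial bound the Taylor series of a chain `(f k)' = -f (k + 1)` at `0` converges to
`f 0`. The chain of derivatives need only hold for `y > 0`, with continuity at `0`. -/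
theorem hasSum_taylor {γ : ℝ} {f : ℕ → ℝ → ℝ} (hf : ∀ k, Continuous (f k))
    (hd : ∀ k y, 0 < y → HasDerivAt (f k) (-(f (k + 1) y)) y) (hb : FactorialBound γ f)
    {y : ℝ} (hy : 0 ≤ y) (hyγ : y < γ) :
    HasSum (fun k => f k 0 * ((-y) ^ k / k !)) (f 0 y) := by
  have hd' : ∀ k y, 0 ≤ y → HasDerivWithinAt (f k) (-(f (k + 1) y)) (Ici y) y := by
    intro k y hy
    rcases hy.eq_or_lt with rfl | hy
    · refine hasDerivWithinAt_Ici_of_tendsto_deriv (s := Ioi 0)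
        (fun z hz => (hd k z hz).differentiableAt.differentiableWithinAt)
        (hf k).continuousWithinAt self_mem_nhdsWithin ?_
      refine (((hf (k + 1)).neg.tendsto 0).mono_left nhdsWithin_le_nhds).congr' ?_
      filter_upwards [self_mem_nhdsWithin] with z hz
      exact (hd k z hz).deriv.symm
    · exact (hd k y hy).hasDerivWithinAt
  obtain ⟨u, hu, hub⟩ := hb.exists_summable hy hyγ
  have hs : Summable fun k => f k 0 * ((-y) ^ k / k !) :=
    Summable.of_norm_bounded hu fun k => hub k 0 (-y) (by rw [abs_neg, abs_of_nonneg hy])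
  obtain ⟨B, p, hB⟩ := hb
  have hγ : 0 < γ := hy.trans_lt hyγ
  have hlim : Tendsto (fun n => B * ((n + p)! / γ ^ n) * (y ^ n / n !)) atTop (𝓝 0) := by
    have hc : FactorialBound γ fun k _ => B * ((k + p)! / γ ^ k) := by
      refine ⟨|B|, p, fun k _ => ?_⟩
      rw [abs_mul, abs_of_nonneg (by positivity : (0 : ℝ) ≤ (k + p)! / γ ^ k)]
    obtain ⟨v, hv, hvb⟩ := hc.exists_summable hy hyγ
    exact (Summable.of_norm_bounded hv fun k => hvb k 0 y (abs_of_nonneg hy).le).tendsto_atTop_zero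
  rw [hs.hasSum_iff_tendsto_nat, ← tendsto_sub_nhds_zero_iff]
  refine squeeze_zero_norm (fun n => ?_) hlim
  rw [Real.norm_eq_abs, abs_sub_comm]
  exact abs_sub_taylor_le n hf hd' (fun z _ => hB n z) y ⟨hy, le_rfl⟩

/-! ### The modes of the solution driven by boundary data -/

/-- The kernels `K` (for even `k`) and `E` (for odd `k`), which alternate under `-∂_y`. -/
def layerKernel (k : ℕ) : ℝ → ℝ → ℝ := if Even k then erfcKernel else heatKernel

/-- For `a n = g⁽ⁿ⁾` this is `(-∂_y)ᵏ` applied to the solution `∫ K(y,s) g'(t - s) ds` of the heat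
equation on `y > 0` with boundary values `g`. For `k = 2n` it is `∫ K(y,s) g⁽ⁿ⁺¹⁾(t - s) ds` and
for `k = 2n + 1` it is `∫ E(y,s) g⁽ⁿ⁺¹⁾(t - s) ds`; both indices are `k / 2 + 1`. -/
def layerMode (T : ℝ) (a : ℕ → ℝ → ℝ) (k : ℕ) (y t : ℝ) : ℝ :=
  heatConv T (layerKernel k y) (a (k / 2 + 1)) t

/-- The sequence `a n` of derivatives of a function that is flat at `0`, extended to all of `ℝ`: it
vanishes on `(-∞, 0]`, and only its boundedness and continuity are kept beyond `T`. -/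
structure FlatDerivSeq (T γ C : ℝ) (a : ℕ → ℝ → ℝ) : Prop where
  continuous : ∀ n, Continuous (a n)
  bound : ∀ n t, |a n t| ≤ C * ((2 * n)! / γ ^ (2 * n))
  eq_zero : ∀ n t, t ≤ 0 → a n t = 0
  eq_integral : ∀ n, ∀ t ≤ T, a n t = ∫ s in (0 : ℝ)..t, a (n + 1) s

theorem FlatDerivSeq.hasDerivAt {T γ C : ℝ} {a : ℕ → ℝ → ℝ} (ha : FlatDerivSeq T γ C a) (n : ℕ)
    {t : ℝ} (ht : t < T) : HasDerivAt (a n) (a (n + 1) t) t := by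
  have hc := ha.continuous (n + 1)
  refine (intervalIntegral.integral_hasDerivAt_right (a := 0) (hc.intervalIntegrable _ _)
    (hc.stronglyMeasurableAtFilter _ _) hc.continuousAt).congr_of_eventuallyEq ?_
  filter_upwards [Iio_mem_nhds ht] with s hs
  exact ha.eq_integral n s (le_of_lt hs)

theorem layerKernel_two_mul (n : ℕ) : layerKernel (2 * n) = erfcKernel := by
  simp [layerKernel]

theorem layerKernel_two_mul_add_one (n : ℕ) : layerKernel (2 * n + 1) = heatKernel := by
  simp [layerKernel]

theorem layerKernel_add_two (k : ℕ) : layerKernel (k + 2) = layerKernel k := by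
  simp [layerKernel, Nat.even_add]

theorem measurable_layerKernel (k : ℕ) (y : ℝ) : Measurable (layerKernel k y) := by
  unfold layerKernel
  split_ifs
  exacts [measurable_erfcKernel y, measurable_heatKernel y]

theorem abs_layerKernel_le (k : ℕ) (y s : ℝ) (hs : 0 < s) :
    |layerKernel k y s| ≤ kernelBound s := by
  unfold layerKernel
  split_ifs
  exacts [abs_erfcKernel_le y s hs, abs_heatKernel_le y s hs]

theorem continuous_layerKernel (k : ℕ) (s : ℝ) : Continuous fun y => layerKernel k y s := by
  unfold layerKernel
  split_ifs
  exacts [continuous_erfcKernel s, continuous_heatKernel s]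

theorem intervalIntegrable_layerKernel {T : ℝ} (hT : 0 ≤ T) (k : ℕ) (y : ℝ) :
    IntervalIntegrable (layerKernel k y) volume 0 T :=
  intervalIntegrable_of_kernelBound hT (measurable_layerKernel k y) (abs_layerKernel_le k y)

theorem heatConv_eq_integral_of_eq_zero {T : ℝ} {κ h : ℝ → ℝ}
    (hκ : IntervalIntegrable κ volume 0 T) (hh : Continuous h) (h0 : ∀ t ≤ 0, h t = 0) {t : ℝ}
    (ht : t ∈ Icc 0 T) : heatConv T κ h t = ∫ s in (0 : ℝ)..t, κ s * h (t - s) := by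
  have hi := intervalIntegrable_mul_comp_sub hκ hh t
  have h1 : uIcc 0 t ⊆ uIcc 0 T := by
    rw [uIcc_of_le ht.1, uIcc_of_le (ht.1.trans ht.2)]; exact Icc_subset_Icc_right ht.2
  have h2 : uIcc t T ⊆ uIcc 0 T := by
    rw [uIcc_of_le ht.2, uIcc_of_le (ht.1.trans ht.2)]; exact Icc_subset_Icc_left ht.1
  rw [heatConv, ← intervalIntegral.integral_add_adjacent_intervals (hi.mono_set h1)
    (hi.mono_set h2), add_eq_left]
  refine (intervalIntegral.integral_congr (g := fun _ => 0) fun s hs => ?_).trans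
    intervalIntegral.integral_zero
  rw [uIcc_of_le ht.2] at hs
  simp only [h0 (t - s) (by linarith [hs.1]), mul_zero]

theorem heatConv_of_nonpos {T t : ℝ} (hT : 0 ≤ T) {κ h : ℝ → ℝ} (h0 : ∀ t ≤ 0, h t = 0)
    (ht : t ≤ 0) : heatConv T κ h t = 0 := by
  refine (intervalIntegral.integral_congr (g := fun _ => 0) fun s hs => ?_).trans
    intervalIntegral.integral_zero
  rw [uIcc_of_le hT] at hs
  simp only [h0 (t - s) (by linarith [hs.1]), mul_zero]

namespace FlatDerivSeq

variable {T γ C : ℝ} {a : ℕ → ℝ → ℝ}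

theorem continuous_layerMode (ha : FlatDerivSeq T γ C a) (hT : 0 ≤ T) (k : ℕ) :
    Continuous fun p : ℝ × ℝ => layerMode T a k p.1 p.2 :=
  continuous_heatConv hT (measurable_layerKernel k) (abs_layerKernel_le k)
    (intervalIntegrable_kernelBound 0 T) (fun s _ => continuous_layerKernel k s)
    (ha.continuous _) (ha.bound _)

theorem layerMode_of_nonpos (ha : FlatDerivSeq T γ C a) (hT : 0 ≤ T) (k : ℕ) (y : ℝ) {t : ℝ}
    (ht : t ≤ 0) : layerMode T a k y t = 0 :=
  heatConv_of_nonpos hT (ha.eq_zero _) ht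

theorem hasDerivWithinAt_layerMode_right (ha : FlatDerivSeq T γ C a) (hT : 0 ≤ T) (k : ℕ) (y : ℝ)
    {t : ℝ} (ht : t ∈ Icc 0 T) :
    HasDerivWithinAt (layerMode T a k y) (layerMode T a (k + 2) y t) (Icc 0 T) t := by
  have e : (k + 2) / 2 + 1 = k / 2 + 1 + 1 := by omega
  rw [layerMode, layerKernel_add_two, e]
  exact hasDerivWithinAt_heatConv (intervalIntegrable_layerKernel hT k y) (ha.continuous _)
    (ha.bound _) (ha.eq_integral _) ht

/-- The relation `∂_y = -(shift)`. For even `k` it is `∂_y K = -E`; for odd `k` it comes from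
`∂_y E = -∂_s K` and integration by parts in `s`, and fails at `y = 0`, where `K` does not vanish as
`s → 0`. -/
theorem hasDerivAt_layerMode_left (ha : FlatDerivSeq T γ C a) (hT : 0 < T) (k : ℕ) {y t : ℝ}
    (hy : 0 < y) (ht : t ≤ T) :
    HasDerivAt (fun y => layerMode T a k y t) (-layerMode T a (k + 1) y t) y := by
  rcases Nat.even_or_odd' k with ⟨n, rfl | rfl⟩
  · have e1 : 2 * n / 2 + 1 = n + 1 := by omega
    have e2 : (2 * n + 1) / 2 + 1 = n + 1 := by omega
    simp only [layerMode, layerKernel_two_mul, layerKernel_two_mul_add_one, e1, e2]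
    have h := (hasDerivAt_heatConv_kernel (S := univ) (y := y) (κ := erfcKernel)
      (κ' := fun y s => -heatKernel y s) (b := kernelBound) hT.le univ_mem
      (fun y => intervalIntegrable_of_kernelBound hT.le (measurable_erfcKernel y)
        (abs_erfcKernel_le y)) (measurable_heatKernel y).neg
      (fun s hs z _ => by rw [abs_neg]; exact abs_heatKernel_le z s hs)
      (intervalIntegrable_kernelBound 0 T) (fun s hs z _ => hasDerivAt_erfcKernel_left z s hs)
      (ha.continuous (n + 1)) (ha.bound (n + 1)) t).2
    refine h.congr_deriv ?_
    simp only [heatConv, neg_mul, intervalIntegral.integral_neg]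
  · have e1 : (2 * n + 1) / 2 + 1 = n + 1 := by omega
    have e2 : (2 * n + 1 + 1) / 2 + 1 = n + 1 + 1 := by omega
    have e3 : layerKernel (2 * n + 1 + 1) = erfcKernel := layerKernel_two_mul (n + 1)
    simp only [layerMode, e3, layerKernel_two_mul_add_one, e1, e2]
    rw [← heatConv_heatKernelDeriv hT hy (ha.continuous _) (ha.continuous _)
      (fun t ht => ha.hasDerivAt (n + 1) ht) (ha.eq_zero _) ht]
    exact (hasDerivAt_heatConv_kernel (S := Ioi (y / 2)) (y := y) (κ := heatKernel)
      (κ' := heatKernelDeriv) (b := fun s => 2 / (y / 2) * kernelBound s) hT.le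
      (Ioi_mem_nhds (by linarith))
      (fun y => intervalIntegrable_of_kernelBound hT.le (measurable_heatKernel y)
        (abs_heatKernel_le y)) (measurable_heatKernelDeriv y)
      (fun s hs z hz => abs_heatKernelDeriv_le (y / 2) z s (by linarith) (le_of_lt hz) hs)
      ((intervalIntegrable_kernelBound 0 T).const_mul _)
      (fun s _ z _ => hasDerivAt_heatKernel_left z s)
      (ha.continuous (n + 1)) (ha.bound (n + 1)) t).2

theorem factorialBound_layerMode (ha : FlatDerivSeq T γ C a) (hT : 0 ≤ T) (hγ : 0 < γ) :
    ∃ (B : ℝ) (p : ℕ), ∀ k y t, |layerMode T a k y t| ≤ B * ((k + p)! / γ ^ k) := by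
  have hC : 0 ≤ C := by simpa using (abs_nonneg _).trans (ha.bound 0 0)
  have hI : 0 ≤ ∫ s in (0 : ℝ)..T, kernelBound s := by
    rw [intervalIntegral.integral_of_le hT]
    exact setIntegral_nonneg measurableSet_Ioc fun s hs => kernelBound_nonneg hs.1
  refine ⟨(∫ s in (0 : ℝ)..T, kernelBound s) * (C * (1 / γ + 1 / γ ^ 2)), 2, fun k y t => ?_⟩
  refine (abs_heatConv_le hT (abs_layerKernel_le k y) (intervalIntegrable_kernelBound 0 T)
    (ha.bound _)).trans ?_
  rw [mul_assoc, mul_assoc]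
  refine mul_le_mul_of_nonneg_left (mul_le_mul_of_nonneg_left ?_ hC) hI
  rcases Nat.even_or_odd' k with ⟨n, rfl | rfl⟩
  -- The index `k / 2 + 1` overshoots: `2 (k / 2 + 1)` is `k + 2` or `k + 1`, whence the summands
  -- `1 / γ ^ 2` and `1 / γ`.
  · have e1 : 2 * (2 * n / 2 + 1) = 2 * n + 2 := by omega
    rw [e1, add_mul]
    have e : ((2 * n + 2)! : ℝ) / γ ^ (2 * n + 2) = 1 / γ ^ 2 * ((2 * n + 2)! / γ ^ (2 * n)) := by
      rw [pow_add]; field_simp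
    rw [e]
    exact le_add_of_nonneg_left (by positivity)
  · have e1 : 2 * ((2 * n + 1) / 2 + 1) = 2 * n + 1 + 1 := by omega
    rw [e1, add_mul]
    have e : ((2 * n + 1 + 1)! : ℝ) / γ ^ (2 * n + 1 + 1)
        = 1 / γ * ((2 * n + 1 + 1)! / γ ^ (2 * n + 1)) := by
      rw [pow_succ]; field_simp
    rw [e]
    refine le_add_of_le_of_nonneg ?_ (by positivity)
    gcongr
    omega

/-- At `y = 0` the kernel `K` is `1`, so the even modes are the derivatives of the data. -/
theorem layerMode_two_mul_zero (ha : FlatDerivSeq T γ C a) (n : ℕ) {t : ℝ}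
    (ht : t ∈ Icc 0 T) : layerMode T a (2 * n) 0 t = a n t := by
  have e1 : 2 * n / 2 + 1 = n + 1 := by omega
  rw [layerMode, layerKernel_two_mul, e1, heatConv_eq_integral_of_eq_zero
    (intervalIntegrable_of_kernelBound (ht.1.trans ht.2) (measurable_erfcKernel 0)
      (abs_erfcKernel_le 0)) (ha.continuous _) (ha.eq_zero _) ht]
  simp [erfcKernel, erfc_zero, intervalIntegral.integral_comp_sub_left (fun s => a (n + 1) s),
    ha.eq_integral n t ht.2]

/-- The half integral is convolution with `E(0,s) = 1/√(πs)`, as `Γ(1/2) = √π`. -/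
theorem fracIntegral_eq (ha : FlatDerivSeq T γ C a) {g : ℝ → ℝ}
    (hg : ∀ t ∈ Icc 0 T, g t = a 0 t) {t : ℝ} (ht : t ∈ Icc 0 T) :
    fracIntegral (1 / 2) g t = heatConv T (heatKernel 0) (a 0) t := by
  rw [heatConv_eq_integral_of_eq_zero
    (intervalIntegrable_of_kernelBound (ht.1.trans ht.2) (measurable_heatKernel 0)
      (abs_heatKernel_le 0)) (ha.continuous _) (ha.eq_zero _) ht, fracIntegral,
    ← intervalIntegral.integral_const_mul]
  have h := intervalIntegral.integral_comp_sub_left (a := 0) (b := t)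
    (fun s => heatKernel 0 s * a 0 (t - s)) t
  rw [sub_self, sub_zero] at h
  rw [← h]
  refine intervalIntegral.integral_congr fun s hs => ?_
  rw [uIcc_of_le ht.1] at hs
  simp only [sub_sub_cancel, hg s ⟨hs.1, hs.2.trans ht.2⟩]
  rw [← mul_assoc]
  congr 1
  rw [Real.Gamma_one_half_eq, heatKernel, Real.sqrt_mul Real.pi_pos.le]
  rcases (sub_nonneg.2 hs.2).eq_or_lt with h0 | h0
  · -- at `s = t` both sides are `0`, by the conventions for powers and quotients at `0`
    rw [← h0]
    norm_num
  · have : (1 / 2 - 1 : ℝ) = -(1 / 2) := by norm_num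
    rw [this, rpow_neg_half _ h0]
    simp [mul_comm]

theorem iteratedDerivWithin_fracIntegral (ha : FlatDerivSeq T γ C a) (hT : 0 < T) {g : ℝ → ℝ}
    (hg : ∀ t ∈ Icc 0 T, g t = a 0 t) (n : ℕ) : ∀ t ∈ Icc 0 T,
    iteratedDerivWithin n (fracIntegral (1 / 2) g) (Icc 0 T) t
      = heatConv T (heatKernel 0) (a n) t := by
  induction n with
  | zero => intro t ht; rw [iteratedDerivWithin_zero]; exact ha.fracIntegral_eq hg ht
  | succ n ih =>
    intro t ht
    rw [iteratedDerivWithin_succ, derivWithin_congr ih (ih t ht)]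
    exact (hasDerivWithinAt_heatConv
      (intervalIntegrable_of_kernelBound hT.le (measurable_heatKernel 0) (abs_heatKernel_le 0))
      (ha.continuous _) (ha.bound _) (ha.eq_integral n) ht).derivWithin
      (uniqueDiffOn_Icc hT t ht)

/-- At `y = 0` the odd modes are the half-integer Riemann-Liouville derivatives of the data. -/
theorem layerMode_two_mul_add_one_zero (ha : FlatDerivSeq T γ C a) (hT : 0 < T) {g : ℝ → ℝ}
    (hg : ∀ t ∈ Icc 0 T, g t = a 0 t) (n : ℕ) {t : ℝ} (ht : t ∈ Icc 0 T) :
    layerMode T a (2 * n + 1) 0 t = fracDeriv T (n + 1 / 2) g t := by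
  have e1 : (2 * n + 1) / 2 + 1 = n + 1 := by omega
  have e2 : ⌊(n : ℝ) + 1 / 2⌋₊ = n := by
    rw [Nat.floor_eq_iff (by positivity)]; constructor <;> linarith
  have e3 : (n : ℝ) - (n + 1 / 2) + 1 = 1 / 2 := by ring
  rw [layerMode, layerKernel_two_mul_add_one, e1, fracDeriv, e2, e3,
    ha.iteratedDerivWithin_fracIntegral hT hg (n + 1) t ht]

end FlatDerivSeq

/-! ### Derivatives of functions in the Holmgren class -/

/-- The derivatives of `g`, extended from `[0, T]` by their values at the end points. The Holmgren
bound, given on the open interval, passes to the end points by continuity. -/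
theorem exists_flatDerivSeq {γ₁ γ₂ C : ℝ} (hγ₂ : 0 < γ₂) {g : ℝ → ℝ}
    (hgH : g ∈ HolmgrenL γ₁ γ₂ C) (hgM : g ∈ FlatSmooth (2 * γ₂)) :
    ∃ a : ℕ → ℝ → ℝ, FlatDerivSeq (2 * γ₂) γ₁ C a ∧
      ∀ n, ∀ t ∈ Icc 0 (2 * γ₂), a n t = iteratedDerivWithin n g (Icc 0 (2 * γ₂)) t := by
  set T := 2 * γ₂ with hTdef
  have hT : 0 < T := by positivity
  have hball : Metric.ball γ₂ γ₂ = Ioo 0 T := by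
    rw [Real.ball_eq_Ioo]; congr 1 <;> linarith
  have hcl : ∀ t, max 0 (min t T) ∈ Icc 0 T := fun t =>
    ⟨le_max_left _ _, max_le hT.le (min_le_right _ _)⟩
  have hid : ∀ t ∈ Icc 0 T, max 0 (min t T) = t := fun t ht => by
    rw [min_eq_left ht.2, max_eq_right ht.1]
  have hcont : ∀ n, ContinuousOn (iteratedDerivWithin n g (Icc 0 T)) (Icc 0 T) := fun n =>
    hgM.1.continuousOn_iteratedDerivWithin (mod_cast le_top) (uniqueDiffOn_Icc hT)
  have hac : ∀ n, Continuous fun t => iteratedDerivWithin n g (Icc 0 T) (max 0 (min t T)) :=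
    fun n => (hcont n).comp_continuous (by fun_prop) hcl
  have hbd : ∀ n, ∀ t ∈ Icc 0 T,
      |iteratedDerivWithin n g (Icc 0 T) t| ≤ C * ((2 * n)! / γ₁ ^ (2 * n)) := by
    intro n
    obtain ⟨B, hB, hBb⟩ := hgH.2 n
    rw [hball] at hBb
    have hin : ∀ t ∈ Ioo 0 T,
        |iteratedDerivWithin n g (Icc 0 T) t| ≤ C * ((2 * n)! / γ₁ ^ (2 * n)) := by
      intro t ht
      have e : iteratedDerivWithin n g (Icc 0 T) t = iteratedDerivWithin n g (Ioo 0 T) t := by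
        simp only [iteratedDerivWithin]
        rw [iteratedFDerivWithin_congr_set]
        filter_upwards [Ioo_mem_nhds ht.1 ht.2] with s hs
        exact propext ⟨fun _ => hs, fun _ => Ioo_subset_Icc_self hs⟩
      rw [e, ← mul_div_assoc]
      exact (hBb t ht).trans hB.le
    have := ContinuousOn.image_closure (s := Ioo 0 T)
      (f := fun t => |iteratedDerivWithin n g (Icc 0 T) t|)
      (by rw [closure_Ioo hT.ne]; exact (hcont n).abs)
    rw [closure_Ioo hT.ne] at this
    intro t ht
    have hm := this (mem_image_of_mem _ ht)
    exact closure_minimal (image_subset_iff.2 hin : _ ⊆ Iic (C * ((2 * n)! / γ₁ ^ (2 * n))))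
      isClosed_Iic hm
  have hzero : ∀ n t, t ≤ 0 → iteratedDerivWithin n g (Icc 0 T) (max 0 (min t T)) = 0 := by
    intro n t ht
    rw [max_eq_left ((min_le_left _ _).trans ht)]
    exact hgM.2 n
  refine ⟨fun n t => iteratedDerivWithin n g (Icc 0 T) (max 0 (min t T)),
    ⟨hac, fun n t => hbd n _ (hcl t), hzero, fun n t ht => ?_⟩,
    fun n t ht => by simp only [hid t ht]⟩
  rcases le_total t 0 with h | h
  · simp only [hzero n t h]
    symm
    refine (intervalIntegral.integral_congr (g := fun _ => 0) fun s hs => ?_).trans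
      intervalIntegral.integral_zero
    rw [uIcc_of_ge h] at hs
    simp only [hzero (n + 1) s hs.2]
  · rw [intervalIntegral.integral_eq_sub_of_hasDerivAt_of_le
      (f := fun t => iteratedDerivWithin n g (Icc 0 T) (max 0 (min t T))) h (hac n).continuousOn
      (fun s hs => ?_) ((hac (n + 1)).intervalIntegrable _ _), hzero n 0 le_rfl, sub_zero]
    have hs' : s ∈ Ioo 0 T := ⟨hs.1, hs.2.trans_le ht⟩
    have hd : HasDerivAt (iteratedDerivWithin n g (Icc 0 T))
        (iteratedDerivWithin (n + 1) g (Icc 0 T) s) s := by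
      rw [iteratedDerivWithin_succ]
      exact ((hgM.1.differentiableOn_iteratedDerivWithin (m := n)
        (by exact_mod_cast ENat.natCast_lt_top n) (uniqueDiffOn_Icc hT)) s (Ioo_subset_Icc_self
          hs')).hasDerivWithinAt.hasDerivAt
        (Icc_mem_nhds hs'.1 hs'.2)
    simp only [hid s (Ioo_subset_Icc_self hs')]
    refine hd.congr_of_eventuallyEq ?_
    filter_upwards [Ioo_mem_nhds hs'.1 hs'.2] with r hr
    rw [hid r (Ioo_subset_Icc_self hr)]

/-! ### The solution on the semi-infinite bar -/

theorem FactorialBound.shift_add {γ : ℝ} {c : ℕ → ℝ → ℝ} (hγ : 0 < γ) (h : FactorialBound γ c)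
    (j : ℕ) : FactorialBound γ fun k => c (k + j) := by
  induction j with
  | zero => exact h
  | succ j ih =>
    have := ih.shift hγ
    simp only [add_right_comm _ 1 j] at this
    exact this

theorem FactorialBound.convergesAbsUnifOn {γ r x₀ T : ℝ} {c : ℕ → ℝ → ℝ}
    {f : ℕ → ℝ → ℝ → ℝ} {m : ℕ → ℕ} (h : FactorialBound γ c) (hm : Function.Injective m)
    (hf : ∀ n x, ∀ t ∈ Icc 0 T, f n x t = c (m n) t * ((x₀ - x) ^ m n / (m n)!))
    (hγ : 0 < γ) (hr : r < γ) :
    ConvergesAbsUnifOn f ({x | |x₀ - x| ≤ r} ×ˢ Icc 0 T) := by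
  obtain ⟨u, hu, hb⟩ := h.exists_summable (le_max_right r 0) (max_lt hr hγ)
  have hle : ∀ n, ∀ p ∈ {x | |x₀ - x| ≤ r} ×ˢ Icc 0 T, |f n p.1 p.2| ≤ u (m n) := by
    rintro n ⟨x, t⟩ ⟨hx, ht⟩
    simp only [hf n x t ht]
    exact hb _ _ _ (le_max_of_le_left hx)
  have hu' : Summable fun n => u (m n) := hu.comp_injective hm
  refine ⟨fun p hp => Summable.of_nonneg_of_le (fun n => abs_nonneg _) (fun n => hle n p hp) hu',
    ?_⟩
  exact tendstoUniformlyOn_tsum_nat hu' hle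

/-- The `k`-th derivative `(-∂_x)ᵏ w` of the solution `w` on the semi-infinite bar: the power series
to the left of `x₀ + ρ` and the convolution with the kernels `K`, `E` from there on. -/
def barSolution (T ρ x₀ : ℝ) (a : ℕ → ℝ → ℝ) (k : ℕ) (x t : ℝ) : ℝ :=
  if x - x₀ < ρ then expSeries (fun j => layerMode T a (j + k) 0) (x₀ - x) t
  else layerMode T a k (x - x₀) t

namespace FlatDerivSeq

variable {T γ C ρ x₀ : ℝ} {a : ℕ → ℝ → ℝ}

theorem factorialBound_layerMode_zero (ha : FlatDerivSeq T γ C a) (hT : 0 ≤ T) (hγ : 0 < γ)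
    (k : ℕ) : FactorialBound γ fun j => layerMode T a (j + k) 0 := by
  have : FactorialBound γ fun j => layerMode T a j 0 := by
    obtain ⟨B, p, h⟩ := ha.factorialBound_layerMode hT hγ
    exact ⟨B, p, fun k t => h k 0 t⟩
  exact this.shift_add hγ k

theorem continuous_layerMode_zero (ha : FlatDerivSeq T γ C a) (hT : 0 ≤ T) (k : ℕ) :
    Continuous (layerMode T a k 0) :=
  (ha.continuous_layerMode hT k).comp (Continuous.prodMk_right 0)

/-- To the right of `x₀` the power series is the convolution: the series is the Taylor series at
`y = 0` of the latter, and the remainder tends to `0`. -/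
theorem expSeries_eq_layerMode (ha : FlatDerivSeq T γ C a) (hT : 0 < T) (hγ : 0 < γ) (k : ℕ)
    {y t : ℝ} (hy : 0 ≤ y) (hyγ : y < γ) (ht : t ≤ T) :
    expSeries (fun j => layerMode T a (j + k) 0) (-y) t = layerMode T a k y t := by
  -- the time is now the fixed parameter and the position is the variable of the bounded functions
  have hb : FactorialBound γ fun j y => layerMode T a (j + k) y t := by
    have : FactorialBound γ fun j y => layerMode T a j y t := by
      obtain ⟨B, p, h⟩ := ha.factorialBound_layerMode hT.le hγ
      exact ⟨B, p, fun k y => h k y t⟩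
    exact this.shift_add hγ k
  have h := hasSum_taylor (f := fun j y => layerMode T a (j + k) y t)
    (fun j => (ha.continuous_layerMode hT.le (j + k)).comp (Continuous.prodMk_left t))
    (fun j y hy => by
      rw [add_right_comm j 1 k]
      exact ha.hasDerivAt_layerMode_left hT (j + k) hy ht) hb hy hyγ
  simp only [zero_add] at h
  exact h.tsum_eq

theorem barSolution_of_lt (x t : ℝ) (k : ℕ) (hx : x - x₀ < ρ) :
    barSolution T ρ x₀ a k x t
      = expSeries (fun j => layerMode T a (j + k) 0) (x₀ - x) t := if_pos hx

theorem barSolution_of_pos (ha : FlatDerivSeq T γ C a) (hT : 0 < T) (hγ : 0 < γ) (hρ : ρ ≤ γ)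
    {x t : ℝ} (k : ℕ) (hx : x₀ < x) (ht : t ≤ T) :
    barSolution T ρ x₀ a k x t = layerMode T a k (x - x₀) t := by
  unfold barSolution
  split_ifs with h
  · rw [← ha.expSeries_eq_layerMode hT hγ k (sub_pos.2 hx).le (h.trans_le hρ) ht, neg_sub]
  · rfl

theorem continuousOn_barSolution (ha : FlatDerivSeq T γ C a) (hT : 0 < T) (hγ : 0 < γ)
    (hρ0 : 0 < ρ) (hρ : ρ ≤ γ) (k : ℕ) :
    ContinuousOn (fun p : ℝ × ℝ => barSolution T ρ x₀ a k p.1 p.2)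
      (Ioi (x₀ - ρ) ×ˢ Icc 0 T) := by
  rintro ⟨x, t⟩ ⟨hx, ht⟩
  rcases lt_or_ge (x - x₀) ρ with h | h
  · have hx' : |x₀ - x| < γ :=
      (abs_lt.2 ⟨by linarith, by linarith [mem_Ioi.1 hx]⟩ : |x₀ - x| < ρ).trans_le hρ
    have hc := continuousAt_expSeries (ha.factorialBound_layerMode_zero hT.le hγ k)
      (fun j => ha.continuous_layerMode_zero hT.le (j + k)) hx' t
    have hc' : ContinuousAt (fun p : ℝ × ℝ =>
        expSeries (fun j => layerMode T a (j + k) 0) (x₀ - p.1) p.2) (x, t) :=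
      ContinuousAt.comp (x := (x, t)) (f := fun p : ℝ × ℝ => (x₀ - p.1, p.2))
        (g := fun p : ℝ × ℝ => expSeries (fun j => layerMode T a (j + k) 0) p.1 p.2) hc
        (Continuous.continuousAt (by fun_prop))
    refine (hc'.congr ?_).continuousWithinAt
    have : {p : ℝ × ℝ | p.1 - x₀ < ρ} ∈ 𝓝 (x, t) :=
      (isOpen_lt (by fun_prop) continuous_const).mem_nhds h
    filter_upwards [this] with p hp
    exact (barSolution_of_lt p.1 p.2 k hp).symm
  · have hc : Continuous fun p : ℝ × ℝ => layerMode T a k (p.1 - x₀) p.2 :=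
      (ha.continuous_layerMode hT.le k).comp
        ((continuous_fst.sub continuous_const).prodMk continuous_snd)
    have hx' : x₀ < x := by linarith
    refine hc.continuousWithinAt.congr_of_eventuallyEq ?_
      (ha.barSolution_of_pos hT hγ hρ k hx' ht.2)
    have : {p : ℝ × ℝ | x₀ < p.1} ∈ 𝓝 (x, t) :=
      (isOpen_lt continuous_const continuous_fst).mem_nhds hx'
    filter_upwards [mem_nhdsWithin_of_mem_nhds this, self_mem_nhdsWithin] with p hp hp2
    exact ha.barSolution_of_pos hT hγ hρ k hp hp2.2.2

theorem hasDerivAt_barSolution_left (ha : FlatDerivSeq T γ C a) (hT : 0 < T) (hγ : 0 < γ)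
    (hρ0 : 0 < ρ) (hρ : ρ ≤ γ) (k : ℕ) {x t : ℝ} (hx : x₀ - ρ < x) (ht : t ≤ T) :
    HasDerivAt (fun x => barSolution T ρ x₀ a k x t) (-barSolution T ρ x₀ a (k + 1) x t) x := by
  rcases lt_or_ge (x - x₀) ρ with h | h
  · have hx' : |x₀ - x| < γ :=
      (abs_lt.2 ⟨by linarith, by linarith⟩ : |x₀ - x| < ρ).trans_le hρ
    have hd := (hasDerivAt_expSeries_left (ha.factorialBound_layerMode_zero hT.le hγ k) hx' t).comp
      x ((hasDerivAt_id x).const_sub x₀)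
    refine HasDerivAt.congr_deriv (hd.congr_of_eventuallyEq ?_) ?_
    rotate_left
    · rw [barSolution_of_lt x t (k + 1) h, mul_neg_one]
      simp only [add_right_comm _ 1 k, add_assoc]
    · have : {x : ℝ | x - x₀ < ρ} ∈ 𝓝 x := (isOpen_lt (by fun_prop) continuous_const).mem_nhds h
      filter_upwards [this] with z hz
      exact barSolution_of_lt z t k hz
  · have hx' : x₀ < x := by linarith
    have hd := (ha.hasDerivAt_layerMode_left hT k (sub_pos.2 hx') ht).comp_sub_const x x₀
    rw [ha.barSolution_of_pos hT hγ hρ (k + 1) hx' ht]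
    refine hd.congr_of_eventuallyEq ?_
    filter_upwards [Ioi_mem_nhds hx'] with z hz
    exact ha.barSolution_of_pos hT hγ hρ k hz ht

theorem hasDerivWithinAt_barSolution_right (ha : FlatDerivSeq T γ C a) (hT : 0 < T) (hγ : 0 < γ)
    (hρ : ρ ≤ γ) (k : ℕ) {x t : ℝ} (hx : x₀ - ρ < x) (ht : t ∈ Icc 0 T) :
    HasDerivWithinAt (barSolution T ρ x₀ a k x) (barSolution T ρ x₀ a (k + 2) x t)
      (Icc 0 T) t := by
  unfold barSolution
  split_ifs with h
  · have hx' : |x₀ - x| < γ :=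
      (abs_lt.2 ⟨by linarith, by linarith⟩ : |x₀ - x| < ρ).trans_le hρ
    refine hasDerivWithinAt_expSeries_right (ha.factorialBound_layerMode_zero hT.le hγ (k + 2))
      (fun j t ht => ha.hasDerivWithinAt_layerMode_right hT.le (j + k) 0 ht)
      (fun j => ha.continuous_layerMode_zero hT.le _)
      (fun j => ha.layerMode_of_nonpos hT.le (j + k) 0 le_rfl) hx' ht
  · exact ha.hasDerivWithinAt_layerMode_right hT.le k _ ht

theorem solvesInverseHeat_barSolution (ha : FlatDerivSeq T γ C a) (hT : 0 < T) (hγ : 0 < γ)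
    (hρ0 : 0 < ρ) (hρ : ρ ≤ γ) {g : ℝ → ℝ} (hg : ∀ t ∈ Icc 0 T, a 0 t = g t) :
    SolvesInverseHeat (Ioi (x₀ - ρ)) x₀ T g (barSolution T ρ x₀ a 0) where
  continuousOn := ha.continuousOn_barSolution hT hγ hρ0 hρ 0
  heat := by
    refine ⟨fun x t => -barSolution T ρ x₀ a 1 x t, barSolution T ρ x₀ a 2,
      (ha.continuousOn_barSolution hT hγ hρ0 hρ 1).neg,
      ha.continuousOn_barSolution hT hγ hρ0 hρ 2, fun x hx t ht => ⟨?_, ?_, ?_⟩⟩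
    · exact (ha.hasDerivAt_barSolution_left hT hγ hρ0 hρ 0 hx ht.2).hasDerivWithinAt
    · exact ((ha.hasDerivAt_barSolution_left hT hγ hρ0 hρ 1 hx ht.2).fun_neg.congr_deriv
        (neg_neg _)).hasDerivWithinAt
    · exact ha.hasDerivWithinAt_barSolution_right hT hγ hρ 0 hx ht
  data := by
    intro t ht
    have h := ha.expSeries_eq_layerMode hT hγ 0 le_rfl hγ ht.2
    rw [neg_zero] at h
    rw [barSolution_of_lt x₀ t 0 (by simpa using hρ0), sub_self, h, ← hg t ht]
    exact ha.layerMode_two_mul_zero 0 ht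
  initial := by
    intro x _
    unfold barSolution
    split_ifs
    · simp [expSeries, ha.layerMode_of_nonpos hT.le _ 0 le_rfl]
    · exact ha.layerMode_of_nonpos hT.le 0 _ le_rfl

theorem heatSeries_eq (ha : FlatDerivSeq T γ C a) (hT : 0 < T) (hγ : 0 < γ) {g : ℝ → ℝ}
    (heven : ∀ n x, ∀ t ∈ Icc 0 T, evenTerm g x₀ T n x t
      = layerMode T a (2 * n) 0 t * ((x₀ - x) ^ (2 * n) / (2 * n)!))
    (hodd : ∀ n x, ∀ t ∈ Icc 0 T, oddTerm g x₀ T n x t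
      = layerMode T a (2 * n + 1) 0 t * ((x₀ - x) ^ (2 * n + 1) / (2 * n + 1)!))
    {x t : ℝ} (hx : |x₀ - x| < γ) (ht : t ∈ Icc 0 T) :
    heatSeries g x₀ T x t = expSeries (fun j => layerMode T a j 0) (x₀ - x) t := by
  obtain ⟨u, hu, hb⟩ :=
    (ha.factorialBound_layerMode_zero hT.le hγ 0).exists_summable (abs_nonneg _) hx
  have hs : Summable fun k => layerMode T a k 0 t * ((x₀ - x) ^ k / k !) :=
    Summable.of_norm_bounded hu fun k => hb k t _ le_rfl
  rw [heatSeries, tsum_congr fun n => heven n x t ht, tsum_congr fun n => hodd n x t ht]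
  exact tsum_even_add_odd
    (f := fun k => layerMode T a k 0 t * ((x₀ - x) ^ k / k !))
    (hs.comp_injective (mul_right_injective₀ two_ne_zero))
    (hs.comp_injective fun i j h => by simpa using h)

end FlatDerivSeq

/-- A solution restricts to smaller sets of positions, and only its values there matter. -/
theorem SolvesInverseHeat.mono_congr {X Y : Set ℝ} {x₀ T : ℝ} {g : ℝ → ℝ} {u w : ℝ → ℝ → ℝ}
    (h : SolvesInverseHeat Y x₀ T g w) (hXY : X ⊆ Y) (hT : 0 ≤ T) (hx₀ : x₀ ∈ X)
    (hu : ∀ x ∈ X, ∀ t ∈ Icc 0 T, u x t = w x t) : SolvesInverseHeat X x₀ T g u where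
  continuousOn := (h.continuousOn.mono (prod_mono_left hXY)).congr fun p hp =>
    hu p.1 hp.1 p.2 hp.2
  heat := by
    obtain ⟨v, q, hv, hq, hvq⟩ := h.heat
    refine ⟨v, q, hv.mono (prod_mono_left hXY), hq.mono (prod_mono_left hXY),
      fun x hx t ht => ?_⟩
    obtain ⟨h1, h2, h3⟩ := hvq x (hXY hx) t ht
    exact ⟨(h1.mono hXY).congr (fun y hy => hu y hy t ht) (hu x hx t ht), h2.mono hXY,
      h3.congr (fun s hs => hu x hx s hs) (hu x hx t ht)⟩
  data := fun t ht => (hu x₀ hx₀ t ht).trans (h.data t ht)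
  initial := fun x hx => (hu x hx 0 (left_mem_Icc.2 hT)).trans (h.initial x (hXY hx))
end

theorem mainTheorem3 (γ₁ γ₂ C x₀ : ℝ) (hγ₁ : 0 < γ₁) (hγ₂ : 0 < γ₂) (hC : 0 < C) (hx₀ : 0 < x₀)
    (g : ℝ → ℝ) (hgH : g ∈ HolmgrenL γ₁ γ₂ C) (hgM : g ∈ FlatSmooth (2 * γ₂)) :
    (∀ r : ℝ, r < Real.sqrt (2 / 5) * γ₁ →
      ConvergesAbsUnifOn (evenTerm g x₀ (2 * γ₂)) ({x | |x₀ - x| ≤ r} ×ˢ Icc 0 (2 * γ₂)) ∧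
      ConvergesAbsUnifOn (oddTerm g x₀ (2 * γ₂)) ({x | |x₀ - x| ≤ r} ×ˢ Icc 0 (2 * γ₂))) ∧
    SolvesInverseHeat {x | |x₀ - x| < Real.sqrt (2 / 5) * γ₁} x₀ (2 * γ₂) g
      (heatSeries g x₀ (2 * γ₂)) ∧
    ∃ w : ℝ → ℝ → ℝ,
      SolvesInverseHeat (Ioi (x₀ - Real.sqrt (2 / 5) * γ₁)) x₀ (2 * γ₂) g w ∧
      ∀ x t : ℝ, |x₀ - x| < Real.sqrt (2 / 5) * γ₁ → t ∈ Icc 0 (2 * γ₂) →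
        w x t = heatSeries g x₀ (2 * γ₂) x t := by
  have hT : 0 < 2 * γ₂ := by positivity
  have hρ0 : 0 < Real.sqrt (2 / 5) * γ₁ := by positivity
  have hρ : Real.sqrt (2 / 5) * γ₁ ≤ γ₁ :=
    mul_le_of_le_one_left hγ₁.le (Real.sqrt_le_one.2 (by norm_num))
  generalize Real.sqrt (2 / 5) * γ₁ = ρ at *
  obtain ⟨a, ha, hag⟩ := exists_flatDerivSeq hγ₂ hgH hgM
  have hg : ∀ t ∈ Icc 0 (2 * γ₂), a 0 t = g t := fun t ht => by
    rw [hag 0 t ht, iteratedDerivWithin_zero]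
  have heven : ∀ n x, ∀ t ∈ Icc 0 (2 * γ₂), evenTerm g x₀ (2 * γ₂) n x t
      = layerMode (2 * γ₂) a (2 * n) 0 t * ((x₀ - x) ^ (2 * n) / (2 * n)!) := fun n x t ht => by
    rw [evenTerm, ha.layerMode_two_mul_zero n ht, hag n t ht]
  have hodd : ∀ n x, ∀ t ∈ Icc 0 (2 * γ₂), oddTerm g x₀ (2 * γ₂) n x t
      = layerMode (2 * γ₂) a (2 * n + 1) 0 t * ((x₀ - x) ^ (2 * n + 1) / (2 * n + 1)!) :=
    fun n x t ht => by
      rw [oddTerm, ha.layerMode_two_mul_add_one_zero hT (fun t ht => (hg t ht).symm) n ht]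
  have hb := ha.factorialBound_layerMode_zero hT.le hγ₁ 0
  have hsol := ha.solvesInverseHeat_barSolution (x₀ := x₀) hT hγ₁ hρ0 hρ hg
  have heq : ∀ x ∈ {x | |x₀ - x| < ρ}, ∀ t ∈ Icc 0 (2 * γ₂),
      heatSeries g x₀ (2 * γ₂) x t = barSolution (2 * γ₂) ρ x₀ a 0 x t := fun x hx t ht => by
    replace hx : |x₀ - x| < ρ := hx
    rw [ha.heatSeries_eq hT hγ₁ heven hodd (hx.trans_le hρ) ht,
      FlatDerivSeq.barSolution_of_lt x t 0 (by linarith [(abs_lt.1 hx).1])]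
    simp only [add_zero]
  refine ⟨fun r hr => ⟨?_, ?_⟩, ?_, _, hsol, fun x t hx ht => (heq x hx t ht).symm⟩
  · exact hb.convergesAbsUnifOn (m := fun n => 2 * n) (mul_right_injective₀ two_ne_zero) heven hγ₁
      (hr.trans_le hρ)
  · exact hb.convergesAbsUnifOn (m := fun n => 2 * n + 1) (fun i j h => by simpa using h) hodd hγ₁
      (hr.trans_le hρ)
  · refine hsol.mono_congr (fun x hx => ?_) hT.le (by simpa using hρ0) heq
    replace hx : |x₀ - x| < ρ := hx
    exact mem_Ioi.2 (by linarith [(abs_lt.1 hx).2])
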